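/- **Proposition 3.1.** Let $k\in\mathbb N$ and let $\Lambda$ be a finite $k$-graph with no sources: a small category with a degree functor $d:\Lambda\to\mathbb N^k$ such that - every $\lambda$ with $d(\lambda)=m+n$ factors uniquely as $\lambda=\mu\nu$ with $d(\mu)=m$, $d(\nu)=n$; - every $\Lambda^n:=d^{-1}(n)$ is finite; - for every vertex $v\in\Lambda^0$ and $n\in\mathbb N^k$ the set $v\Lambda^n$ of $\lambda\in\Lambda^n$ with range $v$ is nonempty. Write $s(\lambda)$ and $r(\lambda)$ for the source and range of $\lambda$, so that $\mu\nu$ is defined when $s(\mu)=r(\nu)$. Let $\Lambda^{\min}(\mu,\nu)$ be the set of pairs $(\eta,\zeta)$ with $\mu\eta=\nu\zeta$ and $d(\mu\eta)=d(\mu)\vee d(\nu)$. The Toeplitz algebra $\mathcal TC^*(\Lambda)$ is the universal $C^*$-algebra generated by partial isometries $\{t_\lambda:\lambda\in\Lambda\}$ such that - (T1) $q_v:=t_v$ $(v\in\Lambda^0)$ are mutually orthogonal projections; - (T2) $t_\lambda t_\mu=t_{\lambda\mu}$ whenever $s(\lambda)=r(\mu)$; - (T3) $t_\lambda^*t_\lambda=q_{s(\lambda)}$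 for all $\lambda$; - (T4) $q_v\ge\sum_{\lambda\in v\Lambda^n}t_\lambda t_\lambda^*$ for all $v\in\Lambda^0$ and $n\in\mathbb N^k$; - (T5) $t_\mu^*t_\nu=\sum_{(\eta,\zeta)\in\Lambda^{\min}(\mu,\nu)}t_\eta t_\zeta^*$ for all $\mu,\nu\in\Lambda$ (empty sums being $0$). Let $\gamma:\mathbb T^k\to\operatorname{Aut}(\mathcal TC^*(\Lambda))$ be the gauge action, $\gamma_z(t_\lambda)=z^{d(\lambda)}t_\lambda$. Let $r\in(0,\infty)^k$ and let $\alpha_t:=\gamma_{e^{itr}}$, $t\in\mathbb R$, where $e^{itr}=(e^{itr_1},\dots,e^{itr_k})$; write $r\cdot n:=\sum_i r_in_i$. An element $a$ of $\mathcal TC^*(\Lambda)$ is analytic if $t\mapsto\alpha_t(a)$ extends to an entire function $z\mapsto\alpha_z(a)$. For $\beta>0$, a state $\phi$ is a KMS$_\beta$ state if $\phi(ab)=\phi(b\,\alpha_{i\beta}(a))$ for all analytic $a,b$. A KMS$_0$ state is an $\alpha$-invariant tracial state. A state $\phi$ is a ground state if for all analytic $a,b$ the function $z\mapsto\phi(a\,\alpha_z(b))$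 is bounded on $\{\operatorname{Im}z>0\}$. Let $\beta\in[0,\infty)$ and let $\phi$ be a state on $\mathcal TC^*(\Lambda)$. 1. If $\phi$ is a KMS$_\beta$ state of $(\mathcal TC^*(\Lambda),\alpha)$, then $\phi(t_\mu t_\nu^*)=\delta_{\mu,\nu}\,e^{-\beta r\cdot d(\mu)}\phi(q_{s(\mu)})$ for all $\mu,\nu\in\Lambda$ with $d(\mu)=d(\nu)$. 2. If $$\phi(t_\mu t_\nu^*)=\delta_{\mu,\nu}\,e^{-\beta r\cdot d(\mu)}\phi(q_{s(\mu)})\quad\text{for all }\mu,\nu\in\Lambda,\qquad(\ast)$$ then $\phi$ is a KMS$_\beta$ state of $(\mathcal TC^*(\Lambda),\alpha)$. If $r$ has rationally independent coordinates, then $\phi$ is a KMS$_\beta$ state of $(\mathcal TC^*(\Lambda),\alpha)$ if and only if $(\ast)$ holds. 3. $\phi$ is a ground state of $(\mathcal TC^*(\Lambda),\alpha)$ if and only if $\phi(t_\mu t_\nu^*)=0$ whenever $r\cdot d(\mu)>0$ or $r\cdot d(\nu)>0$. -/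

import Mathlib

open CategoryTheory
open scoped ENNReal ComplexOrder

universe u w

/-! ### Finite higher-rank graphs -/

/-- A finite `k`-graph on the small category with object set `V`: a degree functor from the category
to the monoid `ℕ^k` with the factorisation property and finitely many morphisms of each degree.
A morphism `f : v ⟶ w` is a path with source `v` and range `w`, so that the path written `μ ν` in
the graph literature (with `s(μ) = r(ν)`) is `ν ≫ μ`. -/
structure FiniteKGraph (k : ℕ) (V : Type u) [SmallCategory V] where
  /-- the degree of a path -/
  deg : ∀ {v w : V}, (v ⟶ w) → (Fin k → ℕ)
  deg_id : ∀ v : V, deg (𝟙 v) = 0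
  deg_comp : ∀ {x v w : V} (f : x ⟶ v) (g : v ⟶ w), deg (f ≫ g) = deg f + deg g
  /-- every `f` of degree `m + n` factors uniquely as `μ ν` with `d(μ) = m` and `d(ν) = n`
  (`p.2.1` is `ν` and `p.2.2` is `μ`) -/
  factorisation : ∀ {v w : V} (f : v ⟶ w) (m n : Fin k → ℕ), deg f = m + n →
    ∃! p : (Σ x : V, (v ⟶ x) × (x ⟶ w)), p.2.1 ≫ p.2.2 = f ∧ deg p.2.2 = m ∧ deg p.2.1 = n
  finite_deg : ∀ n : Fin k → ℕ, {p : Quiver.Total V | deg p.hom = n}.Finite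

namespace FiniteKGraph

variable {k : ℕ} {V : Type u} [SmallCategory V]

/-- The set of all paths (morphisms). -/
abbrev Path (_Λ : FiniteKGraph k V) : Type u := Quiver.Total V

variable (Λ : FiniteKGraph k V)

/-- The degree map on paths. -/
def d (μ : Λ.Path) : Fin k → ℕ := Λ.deg μ.hom

/-- The range of a path. -/
def r (μ : Λ.Path) : V := μ.right

/-- The source of a path. -/
def s (μ : Λ.Path) : V := μ.left

/-- The vertex `v` regarded as a path of degree `0`. -/
def vertex (v : V) : Λ.Path := ⟨v, v, 𝟙 v⟩

/-- The path `μ ν`, defined when `s(μ) = r(ν)`. -/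
def comp (μ ν : Λ.Path) (h : Λ.s μ = Λ.r ν) : Λ.Path :=
  ⟨ν.left, μ.right, ν.hom ≫ eqToHom h.symm ≫ μ.hom⟩

/-- `Λ` has no sources: every `v Λ^n` is nonempty. -/
def NoSources : Prop := ∀ (v : V) (n : Fin k → ℕ), ∃ μ : Λ.Path, Λ.r μ = v ∧ Λ.d μ = n

theorem comp_mk {a b x : V} (f : a ⟶ b) (g : x ⟶ a) (h : a = a) :
    Λ.comp ⟨a, b, f⟩ ⟨x, a, g⟩ h = ⟨x, b, g ≫ f⟩ := by
  change (⟨x, b, g ≫ eqToHom (rfl : a = a) ≫ f⟩ : Λ.Path) = _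
  simp

theorem d_comp (μ ν : Λ.Path) (h : Λ.s μ = Λ.r ν) :
    Λ.d (Λ.comp μ ν h) = Λ.d μ + Λ.d ν := by
  obtain ⟨a, b, f⟩ := μ
  obtain ⟨x, y, g⟩ := ν
  obtain rfl : a = y := h
  rw [comp_mk]
  simp [d, Λ.deg_comp, add_comm]

/-- The finite set `v Λ^n`. -/
noncomputable def pathsTo (v : V) (n : Fin k → ℕ) : Finset Λ.Path :=
  (show {μ : Λ.Path | Λ.r μ = v ∧ Λ.d μ = n}.Finite from
    (Λ.finite_deg n).subset fun _ hμ => hμ.2).toFinset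

@[simp] theorem mem_pathsTo {v : V} {n : Fin k → ℕ} {μ : Λ.Path} :
    μ ∈ Λ.pathsTo v n ↔ Λ.r μ = v ∧ Λ.d μ = n := by
  simp [pathsTo]

/-- The set of pairs `(η, ζ)` with `μ η = ν ζ` and `d(μ η) = d(μ) ∨ d(ν)`. -/
def minExtSet (μ ν : Λ.Path) : Set (Λ.Path × Λ.Path) :=
  {p | ∃ (h : Λ.s μ = Λ.r p.1) (h' : Λ.s ν = Λ.r p.2),
    Λ.comp μ p.1 h = Λ.comp ν p.2 h' ∧ Λ.d (Λ.comp μ p.1 h) = Λ.d μ ⊔ Λ.d ν}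

theorem finite_minExtSet (μ ν : Λ.Path) : (Λ.minExtSet μ ν).Finite := by
  refine ((Λ.finite_deg (Λ.d μ ⊔ Λ.d ν - Λ.d μ)).prod
    (Λ.finite_deg (Λ.d μ ⊔ Λ.d ν - Λ.d ν))).subset ?_
  rintro ⟨η, ζ⟩ ⟨h, h', he, hd⟩
  have hd' := hd
  rw [he, d_comp] at hd'
  rw [d_comp] at hd
  refine ⟨?_, ?_⟩
  · change Λ.d η = _
    rw [← hd, add_tsub_cancel_left]
  · change Λ.d ζ = _
    rw [← hd', add_tsub_cancel_left]

/-- `Λ^min(μ, ν)` as a finite set. -/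
noncomputable def minExt (μ ν : Λ.Path) : Finset (Λ.Path × Λ.Path) :=
  (Λ.finite_minExtSet μ ν).toFinset

@[simp] theorem mem_minExt {μ ν : Λ.Path} {p : Λ.Path × Λ.Path} :
    p ∈ Λ.minExt μ ν ↔ ∃ (h : Λ.s μ = Λ.r p.1) (h' : Λ.s ν = Λ.r p.2),
      Λ.comp μ p.1 h = Λ.comp ν p.2 h' ∧ Λ.d (Λ.comp μ p.1 h) = Λ.d μ ⊔ Λ.d ν := by
  simp [minExt, minExtSet]

/-- Distinct paths of equal degree have no common minimal extension. -/
theorem minExt_eq_empty {μ ν : Λ.Path} (hd : Λ.d μ = Λ.d ν) (hne : μ ≠ ν) :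
    Λ.minExt μ ν = ∅ := by
  refine Finset.eq_empty_of_forall_notMem ?_
  rintro ⟨η, ζ⟩ hp
  obtain ⟨h, h', he, hdeg⟩ := Λ.mem_minExt.1 hp
  apply hne
  have hη : Λ.d η = 0 := by
    rw [d_comp, ← hd, sup_idem] at hdeg
    simpa using hdeg
  have hζ : Λ.d ζ = 0 := by
    rw [he, d_comp, hd, sup_idem] at hdeg
    simpa using hdeg
  obtain ⟨a, b, f⟩ := μ
  obtain ⟨a', b', f'⟩ := ν
  obtain ⟨x, y, g⟩ := η
  obtain ⟨x', y', g'⟩ := ζ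
  obtain rfl : a = y := h
  obtain rfl : a' = y' := h'
  rw [comp_mk, comp_mk] at he
  simp only [Quiver.Total.mk.injEq] at he
  obtain ⟨rfl, rfl, he⟩ := he
  have he := eq_of_heq he
  have hu := Λ.factorisation (g ≫ f) (Λ.deg f) 0
    (by have : Λ.deg g = 0 := hη
        simp [Λ.deg_comp, this])
  have := hu.unique (y₁ := ⟨a, g, f⟩) (y₂ := ⟨a', g', f'⟩) ⟨rfl, rfl, hη⟩ ⟨he.symm, hd.symm, hζ⟩
  cases this
  rfl

end FiniteKGraph

/-! ### Toeplitz-Cuntz-Krieger families -/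

section Toeplitz

variable {k : ℕ} {V : Type u} [SmallCategory V]

/-- A Toeplitz-Cuntz-Krieger `Λ`-family in a C⋆-algebra, with `Q_v = T_v`. In (T4), `a ≥ b` means
that `a - b` is positive, that is, of the form `c⋆ c`. -/
structure IsTCKFamily (Λ : FiniteKGraph k V) {A : Type w} [NonUnitalCStarAlgebra A]
    (T : Λ.Path → A) : Prop where
  partialIsometry : ∀ μ, T μ * star (T μ) * T μ = T μ
  t1_proj : ∀ v, IsStarProjection (T (Λ.vertex v))
  t1_orth : ∀ v v', v ≠ v' → T (Λ.vertex v) * T (Λ.vertex v') = 0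
  t2 : ∀ (μ ν : Λ.Path) (h : Λ.s μ = Λ.r ν), T μ * T ν = T (Λ.comp μ ν h)
  t3 : ∀ μ, star (T μ) * T μ = T (Λ.vertex (Λ.s μ))
  t4 : ∀ (v : V) (n : Fin k → ℕ),
    ∃ c : A, T (Λ.vertex v) - ∑ μ ∈ Λ.pathsTo v n, T μ * star (T μ) = star c * c
  t5 : ∀ μ ν : Λ.Path, star (T μ) * T ν = ∑ p ∈ Λ.minExt μ ν, T p.1 * star (T p.2)

namespace IsTCKFamily

variable {Λ : FiniteKGraph k V} {A : Type w} [NonUnitalCStarAlgebra A] {T : Λ.Path → A}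

/-- The relation (T4) follows from the other relations. -/
theorem of_t5 (h0 : ∀ μ, T μ * star (T μ) * T μ = T μ)
    (h1 : ∀ v, IsStarProjection (T (Λ.vertex v)))
    (h1' : ∀ v v', v ≠ v' → T (Λ.vertex v) * T (Λ.vertex v') = 0)
    (h2 : ∀ (μ ν : Λ.Path) (h : Λ.s μ = Λ.r ν), T μ * T ν = T (Λ.comp μ ν h))
    (h3 : ∀ μ, star (T μ) * T μ = T (Λ.vertex (Λ.s μ)))
    (h5 : ∀ μ ν : Λ.Path, star (T μ) * T ν = ∑ p ∈ Λ.minExt μ ν, T p.1 * star (T p.2)) :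
    IsTCKFamily Λ T := by
  refine ⟨h0, h1, h1', h2, h3, fun v n => ?_, h5⟩
  set q := T (Λ.vertex v) with hq
  set e := ∑ μ ∈ Λ.pathsTo v n, T μ * star (T μ) with he
  have hqe : q * e = e := by
    rw [he, Finset.mul_sum]
    refine Finset.sum_congr rfl fun μ hμ => ?_
    have hr : Λ.s (Λ.vertex v) = Λ.r μ := ((Λ.mem_pathsTo.1 hμ).1).symm
    rw [← mul_assoc, hq, h2 _ _ hr]
    congr 2
    obtain ⟨a, b, f⟩ := μ
    obtain rfl : v = b := hr
    refine (Λ.comp_mk (𝟙 v) f rfl).trans ?_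
    simp
  have hse : star e = e := by
    simp [he, star_sum]
  have hee : e * e = e := by
    conv_lhs => rw [he]
    conv_rhs => rw [he]
    rw [Finset.sum_mul]
    refine Finset.sum_congr rfl fun μ hμ => ?_
    rw [Finset.mul_sum, Finset.sum_eq_single_of_mem μ hμ]
    · rw [← mul_assoc, h0]
    · intro ν hν hne
      have hd : Λ.d μ = Λ.d ν := by
        rw [(Λ.mem_pathsTo.1 hμ).2, (Λ.mem_pathsTo.1 hν).2]
      have : star (T μ) * T ν = 0 := by
        rw [h5, Λ.minExt_eq_empty hd hne.symm, Finset.sum_empty]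
      rw [mul_assoc, ← mul_assoc (star (T μ)), this, zero_mul, mul_zero]
  have hsq : star q = q := (h1 v).isSelfAdjoint
  have hqq : q * q = q := (h1 v).isIdempotentElem
  have heq : e * q = e := by
    have := congrArg star hqe
    rwa [star_mul, hse, hsq] at this
  exact ⟨q - e, by rw [star_sub, hsq, hse, sub_mul, mul_sub, mul_sub, hqq, hqe, heq, hee]; simp⟩

theorem norm_le_one (hT : IsTCKFamily Λ T) (μ : Λ.Path) : ‖T μ‖ ≤ 1 := by
  have h1 : ‖T μ‖ * ‖T μ‖ ≤ 1 := by
    rw [← CStarRing.norm_star_mul_self, hT.t3]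
    exact (hT.t1_proj _).norm_le
  nlinarith [norm_nonneg (T μ)]

theorem map (hT : IsTCKFamily Λ T) {B : Type*} [NonUnitalCStarAlgebra B] (π : A →⋆ₙₐ[ℂ] B) :
    IsTCKFamily Λ fun μ => π (T μ) where
  partialIsometry μ := by rw [← map_star, ← map_mul, ← map_mul, hT.partialIsometry]
  t1_proj v := (hT.t1_proj v).map π
  t1_orth v v' h := by rw [← map_mul, hT.t1_orth v v' h, map_zero]
  t2 μ ν h := by rw [← map_mul, hT.t2 μ ν h]
  t3 μ := by rw [← map_star, ← map_mul, hT.t3]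
  t4 v n := by
    obtain ⟨c, hc⟩ := hT.t4 v n
    refine ⟨π c, ?_⟩
    rw [← map_star, ← map_mul, ← hc, map_sub, map_sum]
    simp only [map_mul, map_star]
  t5 μ ν := by
    rw [← map_star, ← map_mul, hT.t5, map_sum]
    simp only [map_mul, map_star]

/-- A family in a C⋆-subalgebra is a Toeplitz-Cuntz-Krieger family if it is one in the
ambient algebra. -/
theorem of_subalgebra {S : NonUnitalStarSubalgebra ℂ A} [IsClosed (S : Set A)] {T : Λ.Path → S}
    (hT : IsTCKFamily Λ fun μ => (T μ : A)) : IsTCKFamily Λ T := by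
  refine of_t5 (fun μ => Subtype.ext (hT.partialIsometry μ)) (fun v => ?_)
    (fun v v' h => Subtype.ext (hT.t1_orth v v' h)) (fun μ ν h => Subtype.ext (hT.t2 μ ν h))
    (fun μ => Subtype.ext (hT.t3 μ)) (fun μ ν => Subtype.ext ?_)
  · exact ⟨Subtype.ext (hT.t1_proj v).isIdempotentElem, Subtype.ext (hT.t1_proj v).isSelfAdjoint⟩
  · have := hT.t5 μ ν
    push_cast
    exact this

/-- Multiplying a family by `z^{d(μ)}`, `z ∈ 𝕋^k`, gives a family. -/
theorem gauge (hT : IsTCKFamily Λ T) (z : Fin k → Circle) :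
    IsTCKFamily Λ fun μ => ((∏ i, z i ^ Λ.d μ i : Circle) : ℂ) • T μ := by
  have hv : ∀ v, Λ.d (Λ.vertex v) = 0 := Λ.deg_id
  have hstar : ∀ c : Circle, star (c : ℂ) * (c : ℂ) = 1 := fun c => by
    have h := Complex.normSq_eq_conj_mul_self (z := (c : ℂ))
    rw [Circle.normSq_coe] at h
    simpa using h.symm
  have hself : ∀ μ : Λ.Path, ∀ a b : A, ∀ c : Circle,
      ((c : ℂ) • a) * star ((c : ℂ) • b) = a * star b := fun μ a b c => by
    rw [star_smul, smul_mul_smul_comm, mul_comm, hstar, one_smul]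
  refine of_t5 (fun μ => ?_) (fun v => ?_) (fun v v' h => ?_) (fun μ ν h => ?_) (fun μ => ?_)
    (fun μ ν => ?_)
  · rw [hself μ, mul_smul_comm, hT.partialIsometry]
  · simpa [hv] using hT.t1_proj v
  · simpa [hv] using hT.t1_orth v v' h
  · rw [smul_mul_smul_comm, hT.t2 μ ν h, ← Circle.coe_mul, ← Finset.prod_mul_distrib, Λ.d_comp]
    simp [pow_add]
  · rw [star_smul, smul_mul_smul_comm, hstar, one_smul, hT.t3, hv]
    simp
  · rw [star_smul, smul_mul_smul_comm, hT.t5, Finset.smul_sum]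
    refine Finset.sum_congr rfl fun p hp => ?_
    obtain ⟨h, h', he, -⟩ := Λ.mem_minExt.1 hp
    have hdeg : Λ.d μ + Λ.d p.1 = Λ.d ν + Λ.d p.2 := by
      rw [← Λ.d_comp μ p.1 h, he, Λ.d_comp]
    rw [star_smul, smul_mul_smul_comm]
    congr 1
    set P : (Fin k → ℕ) → Circle := fun n => ∏ i, z i ^ n i with hP
    have hadd : ∀ m n, P (m + n) = P m * P n := fun m n => by
      simp [hP, pow_add, Finset.prod_mul_distrib]
    have hmul : (P (Λ.d μ) : ℂ) * P (Λ.d p.1) = P (Λ.d ν) * P (Λ.d p.2) := by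
      rw [← Circle.coe_mul, ← Circle.coe_mul, ← hadd, ← hadd, hdeg]
    change star (P (Λ.d μ) : ℂ) * P (Λ.d ν) = P (Λ.d p.1) * star (P (Λ.d p.2) : ℂ)
    linear_combination (-(star (P (Λ.d μ) : ℂ) * star (P (Λ.d p.2) : ℂ))) * hmul +
      (P (Λ.d p.1) * star (P (Λ.d p.2) : ℂ)) * hstar (P (Λ.d μ)) -
      (star (P (Λ.d μ) : ℂ) * P (Λ.d ν)) * hstar (P (Λ.d p.2))

end IsTCKFamily

/-! ### The Toeplitz algebra -/

/-- A Toeplitz-Cuntz-Krieger `Λ`-family together with the C⋆-algebra it lives in. -/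
structure TCKFamily (Λ : FiniteKGraph k V) where
  carrier : Type u
  [inst : NonUnitalCStarAlgebra carrier]
  T : Λ.Path → carrier
  isTCK : IsTCKFamily Λ T

attribute [instance] TCKFamily.inst

namespace FiniteKGraph

variable (Λ : FiniteKGraph k V)

/-- The direct product (bounded families) of the C⋆-algebras of all Toeplitz-Cuntz-Krieger
families. -/
abbrev TCKProduct : Type (u + 1) := lp (fun F : TCKFamily Λ => F.carrier) ∞

/-- The element `(F.T μ)_F` of the product. -/
noncomputable def productGen (μ : Λ.Path) : Λ.TCKProduct :=
  ⟨fun F => F.T μ, memℓp_infty ⟨1, by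
    rintro _ ⟨F, rfl⟩
    exact F.isTCK.norm_le_one μ⟩⟩

/-- The C⋆-subalgebra of the product that is generated by the elements `(F.T μ)_F`. -/
noncomputable def toeplitzSubalgebra : NonUnitalStarSubalgebra ℂ Λ.TCKProduct :=
  (NonUnitalStarAlgebra.adjoin ℂ (Set.range Λ.productGen)).topologicalClosure

instance : IsClosed (Λ.toeplitzSubalgebra : Set Λ.TCKProduct) :=
  NonUnitalStarSubalgebra.isClosed_topologicalClosure _

/-- The Toeplitz algebra `𝒯C⋆(Λ)`, the universal C⋆-algebra generated by a
Toeplitz-Cuntz-Krieger `Λ`-family. It is realised inside the product over all families; that the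
result has the universal property (with respect to C⋆-algebras in every universe) is proved in
`existsUnique_lift`, and that it is generated by the universal family in `closure_adjoin_t`. -/
def ToeplitzAlgebra : Type (u + 1) := Λ.toeplitzSubalgebra

noncomputable instance : NonUnitalCStarAlgebra Λ.ToeplitzAlgebra :=
  NonUnitalStarSubalgebra.nonUnitalCStarAlgebra Λ.toeplitzSubalgebra

/-- The generators `t_μ` of the Toeplitz algebra. -/
noncomputable def t (μ : Λ.Path) : Λ.ToeplitzAlgebra :=
  (⟨Λ.productGen μ, subset_closure (NonUnitalStarAlgebra.subset_adjoin ℂ _ ⟨μ, rfl⟩)⟩ :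
    Λ.toeplitzSubalgebra)

/-- The vertex projections `q_v` of the Toeplitz algebra. -/
noncomputable def q (v : V) : Λ.ToeplitzAlgebra := Λ.t (Λ.vertex v)

theorem isTCKFamily_t : IsTCKFamily Λ Λ.t := by
  have key : IsTCKFamily Λ Λ.productGen := by
    refine IsTCKFamily.of_t5 (fun μ => ?_) (fun v => ⟨?_, ?_⟩) (fun v v' h => ?_)
      (fun μ ν h => ?_) (fun μ => ?_) (fun μ ν => ?_)
    · exact lp.ext (funext fun F => F.isTCK.partialIsometry μ)
    · exact lp.ext (funext fun F => (F.isTCK.t1_proj v).isIdempotentElem)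
    · exact lp.ext (funext fun F => (F.isTCK.t1_proj v).isSelfAdjoint)
    · exact lp.ext (funext fun F => F.isTCK.t1_orth v v' h)
    · exact lp.ext (funext fun F => F.isTCK.t2 μ ν h)
    · exact lp.ext (funext fun F => F.isTCK.t3 μ)
    · refine lp.ext (funext fun F => ?_)
      rw [lp.coeFn_sum, Finset.sum_apply]
      exact F.isTCK.t5 μ ν
  exact IsTCKFamily.of_subalgebra (S := Λ.toeplitzSubalgebra) (T := Λ.t) key

/-- The Toeplitz algebra is generated, as a C⋆-algebra, by the elements `t_μ`. -/
theorem closure_adjoin_t :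
    (NonUnitalStarAlgebra.adjoin ℂ (Set.range Λ.t)).topologicalClosure = ⊤ := by
  set v : Λ.ToeplitzAlgebra →⋆ₙₐ[ℂ] Λ.TCKProduct :=
    NonUnitalStarSubalgebraClass.subtype Λ.toeplitzSubalgebra with hv
  have hle : NonUnitalStarAlgebra.adjoin ℂ (Set.range Λ.productGen) ≤
      (NonUnitalStarAlgebra.adjoin ℂ (Set.range Λ.t)).map v := by
    refine NonUnitalStarAlgebra.adjoin_le ?_
    rintro _ ⟨μ, rfl⟩
    exact ⟨Λ.t μ, NonUnitalStarAlgebra.subset_adjoin ℂ _ ⟨μ, rfl⟩, rfl⟩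
  refine eq_top_iff.2 fun a _ => ?_
  have ha : v a ∈ closure
      (NonUnitalStarAlgebra.adjoin ℂ (Set.range Λ.productGen) : Set Λ.TCKProduct) :=
    Subtype.property (p := fun x => x ∈ Λ.toeplitzSubalgebra) a
  have ha' := closure_mono (show (NonUnitalStarAlgebra.adjoin ℂ (Set.range Λ.productGen) :
    Set Λ.TCKProduct) ⊆ v '' (NonUnitalStarAlgebra.adjoin ℂ (Set.range Λ.t)) from hle) ha
  exact closure_subtype.2 ha'

/-- A ⋆-homomorphism on the Toeplitz algebra is determined by its values on the `t_μ`. -/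
theorem hom_ext {B : Type w} [NonUnitalCStarAlgebra B] {π ρ : Λ.ToeplitzAlgebra →⋆ₙₐ[ℂ] B}
    (h : ∀ μ, π (Λ.t μ) = ρ (Λ.t μ)) : π = ρ := by
  have : ContinuousLinearMapClass (Λ.ToeplitzAlgebra →⋆ₙₐ[ℂ] B) ℂ Λ.ToeplitzAlgebra B :=
    NonUnitalStarAlgHom.instContinuousLinearMapClassComplex
  have hcl : IsClosed (NonUnitalStarAlgHom.equalizer π ρ : Set Λ.ToeplitzAlgebra) :=
    isClosed_eq (map_continuous π) (map_continuous ρ)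
  have hle : (NonUnitalStarAlgebra.adjoin ℂ (Set.range Λ.t)).topologicalClosure ≤
      NonUnitalStarAlgHom.equalizer π ρ := by
    refine NonUnitalStarSubalgebra.topologicalClosure_minimal _ ?_ hcl
    refine NonUnitalStarAlgebra.adjoin_le ?_
    rintro _ ⟨μ, rfl⟩
    exact h μ
  rw [closure_adjoin_t] at hle
  ext a
  exact hle (x := a) trivial

/-- Formal ⋆-polynomials in the generators, used to see that C⋆-algebras generated by `Λ`-families are small. -/
inductive Word (Λ : FiniteKGraph k V) : Type u
  | gen (μ : Λ.Path)
  | zero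
  | star (a : Word Λ)
  | add (a b : Word Λ)
  | mul (a b : Word Λ)
  | smul (c : ℂ) (a : Word Λ)

variable {Λ} in
/-- The value of a formal ⋆-polynomial. -/
def Word.eval {B : Type w} [NonUnitalCStarAlgebra B] (T : Λ.Path → B) : Λ.Word → B
  | .gen μ => T μ
  | .zero => 0
  | .star a => Star.star (a.eval T)
  | .add a b => a.eval T + b.eval T
  | .mul a b => a.eval T * b.eval T
  | .smul c a => c • a.eval T

theorem small_closure_adjoin {B : Type w} [NonUnitalCStarAlgebra B] (T : Λ.Path → B) :
    Small.{u} (NonUnitalStarAlgebra.adjoin ℂ (Set.range T)).topologicalClosure := by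
  have h1 : ∀ b ∈ NonUnitalStarAlgebra.adjoin ℂ (Set.range T), ∃ a : Λ.Word, a.eval T = b := by
    intro b hb
    induction hb using NonUnitalStarAlgebra.adjoin_induction with
    | mem x hx =>
      obtain ⟨μ, rfl⟩ := hx
      exact ⟨.gen μ, rfl⟩
    | add x y _ _ hx hy =>
      obtain ⟨a, rfl⟩ := hx
      obtain ⟨b, rfl⟩ := hy
      exact ⟨.add a b, rfl⟩
    | zero => exact ⟨.zero, rfl⟩
    | mul x y _ _ hx hy =>
      obtain ⟨a, rfl⟩ := hx
      obtain ⟨b, rfl⟩ := hy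
      exact ⟨.mul a b, rfl⟩
    | smul c x _ hx =>
      obtain ⟨a, rfl⟩ := hx
      exact ⟨.smul c a, rfl⟩
    | star x _ hx =>
      obtain ⟨a, rfl⟩ := hx
      exact ⟨.star a, rfl⟩
  have hsub : ((NonUnitalStarAlgebra.adjoin ℂ (Set.range T)).topologicalClosure : Set B) ⊆
      Set.range fun a : ℕ → Λ.Word => Filter.lim (Filter.map (fun n => (a n).eval T) Filter.atTop) := by
    intro b hb
    obtain ⟨x, hx, hlim⟩ := mem_closure_iff_seq_limit.1
      (show b ∈ closure (NonUnitalStarAlgebra.adjoin ℂ (Set.range T) : Set B) from hb)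
    choose a ha using fun n => h1 (x n) (hx n)
    refine ⟨a, ?_⟩
    simp only [ha]
    exact Filter.Tendsto.limUnder_eq hlim
  exact small_subset hsub

theorem exists_small_copy (S : Type w) [NonUnitalCStarAlgebra S] [Small.{u} S] :
    ∃ (C : Type u) (_ : NonUnitalCStarAlgebra C), Nonempty (C ≃⋆ₐ[ℂ] S) := by
  let e : Shrink.{u} S ≃ S := (equivShrink S).symm
  let i1 : NonUnitalRing (Shrink.{u} S) := e.nonUnitalRing
  let i2 : NonUnitalNormedRing (Shrink.{u} S) :=
    NonUnitalNormedRing.induced (Shrink.{u} S) S e.ringEquiv e.injective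
  let i3 : StarRing (Shrink.{u} S) := e.starRing
  let i4 : Module ℂ (Shrink.{u} S) := e.module ℂ
  let i5 : NormedSpace ℂ (Shrink.{u} S) := NormedSpace.mk (fun c a => by
    change ‖e (e.symm (c • e a))‖ ≤ ‖c‖ * ‖e a‖
    rw [e.apply_symm_apply, norm_smul])
  have hmul : ∀ a b : Shrink.{u} S, e (a * b) = e a * e b := fun a b => e.apply_symm_apply _
  have hsmul : ∀ (c : ℂ) (a : Shrink.{u} S), e (c • a) = c • e a := fun c a => e.apply_symm_apply _
  have hstar : ∀ a : Shrink.{u} S, e (star a) = star (e a) := fun a => e.apply_symm_apply _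
  have hadd : ∀ a b : Shrink.{u} S, e (a + b) = e a + e b := fun a b => e.apply_symm_apply _
  have hiso : Isometry e := AddMonoidHomClass.isometry_of_norm e.ringEquiv fun _ => rfl
  have : CompleteSpace (Shrink.{u} S) :=
    (IsometryEquiv.mk e hiso).completeSpace_iff.2 inferInstance
  have : CStarRing (Shrink.{u} S) := ⟨fun a => by
    change ‖e a‖ * ‖e a‖ ≤ ‖e (star a * a)‖
    rw [hmul, hstar, CStarRing.norm_star_mul_self]⟩
  have : IsScalarTower ℂ (Shrink.{u} S) (Shrink.{u} S) := ⟨fun c a b => e.injective <| by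
    simp only [smul_eq_mul, hmul, hsmul, smul_mul_assoc]⟩
  have : SMulCommClass ℂ (Shrink.{u} S) (Shrink.{u} S) := ⟨fun c a b => e.injective <| by
    simp only [smul_eq_mul, hmul, hsmul, mul_smul_comm]⟩
  have : StarModule ℂ (Shrink.{u} S) := ⟨fun c a => e.injective <| by
    simp only [hstar, hsmul, star_smul]⟩
  exact ⟨Shrink.{u} S, { norm_smul_le := i5.norm_smul_le }, ⟨{ e with
    map_mul' := hmul
    map_add' := hadd
    map_star' := hstar
    map_smul' := hsmul }⟩⟩

/-- The universal property of the Toeplitz algebra: for every Toeplitz-Cuntz-Krieger family `T`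
in a C⋆-algebra there is a unique ⋆-homomorphism with `t_μ ↦ T_μ`. -/
theorem existsUnique_lift {B : Type w} [NonUnitalCStarAlgebra B] {T : Λ.Path → B}
    (hT : IsTCKFamily Λ T) :
    ∃! π : Λ.ToeplitzAlgebra →⋆ₙₐ[ℂ] B, ∀ μ, π (Λ.t μ) = T μ := by
  refine existsUnique_of_exists_of_unique ?_
    fun π ρ hπ hρ => Λ.hom_ext fun μ => (hπ μ).trans (hρ μ).symm
  have key : ∀ F : TCKFamily Λ, ∃ π : Λ.ToeplitzAlgebra →⋆ₙₐ[ℂ] F.carrier,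
      ∀ μ, π (Λ.t μ) = F.T μ := fun F =>
    ⟨{ toFun := fun a => (show Λ.toeplitzSubalgebra from a).1 F
       map_smul' := fun _ _ => rfl
       map_zero' := rfl
       map_add' := fun _ _ => rfl
       map_mul' := fun _ _ => rfl
       map_star' := fun _ => rfl }, fun _ => rfl⟩
  set S := (NonUnitalStarAlgebra.adjoin ℂ (Set.range T)).topologicalClosure with hS
  have : IsClosed (S : Set B) := NonUnitalStarSubalgebra.isClosed_topologicalClosure _
  have : Small.{u} S := Λ.small_closure_adjoin T
  obtain ⟨C, _, ⟨e⟩⟩ := exists_small_copy.{u} S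
  let T' : Λ.Path → S := fun μ =>
    ⟨T μ, subset_closure (NonUnitalStarAlgebra.subset_adjoin ℂ _ ⟨μ, rfl⟩)⟩
  have hT' : IsTCKFamily Λ T' := IsTCKFamily.of_subalgebra (T := T') hT
  obtain ⟨π, hπ⟩ := key ⟨C, _, hT'.map (e.symm : S →⋆ₙₐ[ℂ] C)⟩
  refine ⟨((NonUnitalStarSubalgebraClass.subtype S).comp (e : C →⋆ₙₐ[ℂ] S)).comp π, fun μ => ?_⟩
  have : e (π (Λ.t μ)) = T' μ := by
    rw [hπ μ]
    exact e.apply_symm_apply _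
  exact congrArg Subtype.val this

/-! ### The gauge action and the dynamics -/

/-- The endomorphism `γ_z` of the Toeplitz algebra with `γ_z(t_μ) = z^{d(μ)} t_μ`. -/
noncomputable def gaugeHom (z : Fin k → Circle) : Λ.ToeplitzAlgebra →⋆ₙₐ[ℂ] Λ.ToeplitzAlgebra :=
  (Λ.existsUnique_lift (Λ.isTCKFamily_t.gauge z)).choose

theorem gaugeHom_t (z : Fin k → Circle) (μ : Λ.Path) :
    Λ.gaugeHom z (Λ.t μ) = ((∏ i, z i ^ Λ.d μ i : Circle) : ℂ) • Λ.t μ :=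
  (Λ.existsUnique_lift (Λ.isTCKFamily_t.gauge z)).choose_spec.1 μ

theorem gaugeHom_one : Λ.gaugeHom 1 = NonUnitalStarAlgHom.id ℂ _ :=
  Λ.hom_ext fun μ => by simp [gaugeHom_t]

theorem gaugeHom_mul (z z' : Fin k → Circle) :
    Λ.gaugeHom (z * z') = (Λ.gaugeHom z).comp (Λ.gaugeHom z') :=
  Λ.hom_ext fun μ => by
    rw [NonUnitalStarAlgHom.comp_apply, gaugeHom_t, gaugeHom_t, map_smul, gaugeHom_t, smul_smul,
      ← Circle.coe_mul, ← Finset.prod_mul_distrib]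
    simp [mul_pow, mul_comm]

/-- The gauge action `γ` of `𝕋^k` on the Toeplitz algebra. -/
noncomputable def gaugeAction :
    (Fin k → Circle) →* (Λ.ToeplitzAlgebra ≃⋆ₐ[ℂ] Λ.ToeplitzAlgebra) where
  toFun z :=
    { Λ.gaugeHom z with
      invFun := Λ.gaugeHom z⁻¹
      left_inv := fun a => by
        change (Λ.gaugeHom z⁻¹).comp (Λ.gaugeHom z) a = a
        rw [← gaugeHom_mul, inv_mul_cancel, gaugeHom_one]
        rfl
      right_inv := fun a => by
        change (Λ.gaugeHom z).comp (Λ.gaugeHom z⁻¹) a = a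
        rw [← gaugeHom_mul, mul_inv_cancel, gaugeHom_one]
        rfl }
  map_one' := by
    ext a
    exact congrArg (fun f => f a) Λ.gaugeHom_one
  map_mul' z z' := by
    ext a
    exact congrArg (fun f => f a) (Λ.gaugeHom_mul z z')

theorem gaugeAction_t (z : Fin k → Circle) (μ : Λ.Path) :
    Λ.gaugeAction z (Λ.t μ) = ((∏ i, z i ^ Λ.d μ i : Circle) : ℂ) • Λ.t μ :=
  Λ.gaugeHom_t z μ

end FiniteKGraph

/-- A strongly continuous action of `ℝ` by automorphisms on a C⋆-algebra. -/
structure RealAction (A : Type w) [NonUnitalCStarAlgebra A] where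
  aut : ℝ → (A ≃⋆ₐ[ℂ] A)
  aut_zero : aut 0 = 1
  aut_add : ∀ s t, aut (s + t) = aut s * aut t
  continuous_orbit : ∀ a, Continuous fun t => aut t a

/-- The action `α_t = γ_{e^{itr}}` of `ℝ` on the Toeplitz algebra, for `r ∈ ℝ^k`. -/
noncomputable def FiniteKGraph.dynamics (Λ : FiniteKGraph k V) (r : Fin k → ℝ) :
    RealAction Λ.ToeplitzAlgebra where
  aut t := Λ.gaugeAction fun i => Circle.exp (t * r i)
  aut_zero := by
    rw [← map_one Λ.gaugeAction]
    congr 1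
    ext i
    simp
  aut_add s t := by
    rw [← map_mul]
    congr 1
    ext i
    simp [add_mul, Circle.exp_add]
  continuous_orbit := by
    let γ : ℝ → (Λ.ToeplitzAlgebra ≃⋆ₐ[ℂ] Λ.ToeplitzAlgebra) :=
      fun t => Λ.gaugeAction fun i => Circle.exp (t * r i)
    let S : NonUnitalStarSubalgebra ℂ Λ.ToeplitzAlgebra :=
      { carrier := {a | Continuous fun t => γ t a}
        add_mem' := fun {a b} ha hb => by
          change Continuous fun t => γ t (a + b)
          simp only [map_add]
          exact Continuous.add ha hb
        zero_mem' := by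
          change Continuous fun t => γ t 0
          simp only [map_zero]
          exact continuous_const
        mul_mem' := fun {a b} ha hb => by
          change Continuous fun t => γ t (a * b)
          simp only [map_mul]
          exact Continuous.mul ha hb
        smul_mem' := fun c a ha => by
          change Continuous fun t => γ t (c • a)
          simp only [map_smul]
          exact Continuous.const_smul ha c
        star_mem' := fun {a} ha => by
          change Continuous fun t => γ t (star a)
          simp only [map_star]
          exact Continuous.star ha }
    have hS : IsClosed (S : Set Λ.ToeplitzAlgebra) := by
      refine isClosed_of_closure_subset fun a ha => ?_
      obtain ⟨x, hx, hlim⟩ := mem_closure_iff_seq_limit.1 ha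
      refine TendstoUniformly.continuous (F := fun n t => γ t (x n)) (p := Filter.atTop) ?_
        (Filter.Eventually.of_forall hx).frequently
      rw [Metric.tendstoUniformly_iff]
      intro ε hε
      filter_upwards [Metric.tendsto_nhds.1 hlim ε hε] with n hn t
      rw [dist_comm, dist_eq_norm, ← map_sub, StarAlgEquiv.norm_map, ← dist_eq_norm]
      exact hn
    have htop : (⊤ : NonUnitalStarSubalgebra ℂ Λ.ToeplitzAlgebra) ≤ S := by
      rw [← Λ.closure_adjoin_t]
      refine NonUnitalStarSubalgebra.topologicalClosure_minimal _ ?_ hS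
      refine NonUnitalStarAlgebra.adjoin_le ?_
      rintro _ ⟨μ, rfl⟩
      change Continuous fun t : ℝ => Λ.gaugeAction _ (Λ.t μ)
      simp only [gaugeAction_t]
      fun_prop
    exact fun a => htop (x := a) trivial

/-! ### States, KMS states and ground states -/

section KMS

variable {A : Type w} [NonUnitalCStarAlgebra A]

/-- A state: a positive linear functional of norm one. -/
def IsState (φ : A →L[ℂ] ℂ) : Prop :=
  (∀ a : A, 0 ≤ φ (star a * a)) ∧ ‖φ‖ = 1

/-- `f` is an entire function extending `t ↦ α_t(a)`; it is unique if it exists, and is written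
`z ↦ α_z(a)`. -/
def IsEntireExtension (α : RealAction A) (a : A) (f : ℂ → A) : Prop :=
  Differentiable ℂ f ∧ ∀ t : ℝ, f t = α.aut t a

/-- `a` is analytic for `α`. -/
def IsAnalyticElement (α : RealAction A) (a : A) : Prop :=
  ∃ f : ℂ → A, IsEntireExtension α a f

/-- `φ` is a KMS state of `(A, α)` at inverse temperature `β ≥ 0`: a state such that
`φ(ab) = φ(b α_{iβ}(a))` for all analytic `a`, `b` if `β > 0`, and an `α`-invariant tracial state
if `β = 0`. -/
def IsKMSState (α : RealAction A) (β : ℝ) (φ : A →L[ℂ] ℂ) : Prop :=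
  IsState φ ∧
  (0 < β → ∀ (a b : A) (f : ℂ → A), IsEntireExtension α a f → IsAnalyticElement α b →
    φ (a * b) = φ (b * f (Complex.I * β))) ∧
  (β = 0 → (∀ a b : A, φ (a * b) = φ (b * a)) ∧ ∀ (t : ℝ) (a : A), φ (α.aut t a) = φ a)

/-- `φ` is a ground state of `(A, α)`: a state such that `z ↦ φ(a α_z(b))` is bounded on the
upper half-plane for all analytic `a`, `b`. -/
def IsGroundState (α : RealAction A) (φ : A →L[ℂ] ℂ) : Prop :=
  IsState φ ∧ ∀ (a b : A) (f : ℂ → A), IsAnalyticElement α a → IsEntireExtension α b f →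
    ∃ C : ℝ, ∀ z : ℂ, 0 < z.im → ‖φ (a * f z)‖ ≤ C

end KMS

/-- The pairing `r · n` for `r ∈ ℝ^k` and `n ∈ ℕ^k`. -/
def rdot (r : Fin k → ℝ) (n : Fin k → ℕ) : ℝ := ∑ i, r i * n i

end Toeplitz

/-!
The proof rests on the elements `t_μ t_ν⋆`. By (T5) they span a dense ⋆-subalgebra, and they are
eigenvectors of the dynamics: `α_t(t_μ t_ν⋆) = e^{it r·(d(μ) - d(ν))} t_μ t_ν⋆`.

The necessary conditions come from evaluating the defining properties on eigenvectors. The KMS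
condition for `t_μ` and `t_ν⋆` gives the formula for `d(μ) = d(ν)`; for `t_μ t_ν⋆` and a vertex
projection it makes `φ` vanish on elements of nonzero frequency, which covers `d(μ) ≠ d(ν)` when `r`
has rationally independent coordinates. For a ground state, `φ(t_μ α_z(t_ν⋆))` grows exponentially on
the positive imaginary axis unless `r·d(ν) = 0` or it vanishes.

For the converses the difficulty is to pass from the spanning elements to all analytic elements `a`,
as `α_z(a)` does not depend continuously on `a`. The functionals at hand are `α`-invariant, and so
`φ(b α_z(a)) = φ(α_{-z}(b) a)` for every eigenvector `b` (`apply_mul_entireExtension`): the two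
sides are entire in `z` and agree on the real axis. The right-hand side is continuous in `a`. This
reduces the KMS condition to products of spanning elements (`isKMSState_of_eigenvectors`). For ground
states (`isGroundState_of_eigenvectors`) it shows that `φ(b α_z(a))` is bounded on the upper
half-plane for `b` in the span; by the Phragmen-Lindelöf principle the bound is then its bound
`‖φ‖ ‖b‖ ‖a‖` on the real axis, which persists for `b` in the closure.

On products of spanning elements the KMS condition is combinatorial (`apply_mul_of_diagonal`). By
(T5), `t_μ t_ν⋆ t_σ t_τ⋆` is the sum of the `t_{μη} t_{τζ}⋆` over `(η, ζ) ∈ Λ^min(ν, σ)`, and `φ` only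
sees the terms with `μη = τζ`. For these, both `(η, ζ) ∈ Λ^min(ν, σ)` and `(ζ, η) ∈ Λ^min(τ, μ)` say
that `d(η) ∧ d(ζ) = 0`, so swapping `η` and `ζ` matches them with the terms of the product in the
other order.
-/

/-! ### Eigenvectors of a real action -/

namespace RealAction

variable {A : Type w} [NonUnitalCStarAlgebra A] (α : RealAction A)

/-- `a` is an eigenvector of the action with frequency `c`: `α_t(a) = e^{itc} a` for all `t`. -/
def IsEigenvector (a : A) (c : ℝ) : Prop :=
  ∀ t : ℝ, α.aut t a = Complex.exp (Complex.I * t * c) • a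

variable {α}

theorem IsEigenvector.mul {a b : A} {c c' : ℝ} (ha : α.IsEigenvector a c)
    (hb : α.IsEigenvector b c') : α.IsEigenvector (a * b) (c + c') := fun t => by
  rw [map_mul, ha t, hb t, smul_mul_smul_comm, ← Complex.exp_add]
  push_cast
  ring_nf

theorem IsEigenvector.star {a : A} {c : ℝ} (ha : α.IsEigenvector a c) :
    α.IsEigenvector (star a) (-c) := fun t => by
  rw [map_star, ha t, star_smul]
  congr 1
  rw [RCLike.star_def, ← Complex.exp_conj]
  simp

theorem IsEigenvector.isEntireExtension {a : A} {c : ℝ} (ha : α.IsEigenvector a c) :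
    IsEntireExtension α a fun z => Complex.exp (Complex.I * z * c) • a :=
  ⟨by fun_prop, fun t => (ha t).symm⟩

theorem IsEigenvector.isAnalyticElement {a : A} {c : ℝ} (ha : α.IsEigenvector a c) :
    IsAnalyticElement α a :=
  ⟨_, ha.isEntireExtension⟩

/-- A functional that vanishes on those members of a total family of eigenvectors that have nonzero
frequency is invariant. -/
theorem invariant_of_eigenvectors {φ : A →L[ℂ] ℂ} {ι : Type*} {e : ι → A} {ω : ι → ℝ}
    (he : ∀ i, α.IsEigenvector (e i) (ω i))
    (hdense : Dense (Submodule.span ℂ (Set.range e) : Set A))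
    (h0 : ∀ i, ω i ≠ 0 → φ (e i) = 0) (t : ℝ) (a : A) : φ (α.aut t a) = φ a := by
  have hcont : Continuous (α.aut t) :=
    (AddMonoidHomClass.isometry_of_norm (α.aut t) fun x => StarAlgEquiv.norm_map _ x).continuous
  let θ : A →L[ℂ] A :=
    { toFun := α.aut t
      map_add' := map_add _
      map_smul' := map_smul _
      cont := hcont }
  have : φ.comp θ = φ := by
    refine ContinuousLinearMap.ext_on hdense (Set.forall_mem_range.2 fun i => ?_)
    change φ (α.aut t (e i)) = φ (e i)
    rw [he i t, map_smul]
    by_cases hc : ω i = 0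
    · simp [hc]
    · simp [h0 i hc]
  exact DFunLike.congr_fun this a

end RealAction

/-- Entire functions that agree on the real axis are equal. -/
theorem eq_of_differentiable_of_eq_ofReal {F G : ℂ → ℂ} (hF : Differentiable ℂ F)
    (hG : Differentiable ℂ G) (h : ∀ t : ℝ, F t = G t) : F = G := by
  refine AnalyticOnNhd.eq_of_frequently_eq (z₀ := 0)
    (fun z _ => hF.analyticAt z) (fun z _ => hG.analyticAt z) ?_
  have hlim : Filter.Tendsto (fun t : ℝ => (t : ℂ)) (nhdsWithin 0 {0}ᶜ) (nhdsWithin 0 {0}ᶜ) := by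
    refine tendsto_nhdsWithin_iff.2 ⟨?_, ?_⟩
    · exact (Complex.continuous_ofReal.tendsto' 0 0 (by simp)).mono_left nhdsWithin_le_nhds
    · filter_upwards [self_mem_nhdsWithin] with t ht
      simpa using ht
  exact hlim.frequently (Filter.Frequently.of_forall h)

section States

variable {A : Type w} [NonUnitalCStarAlgebra A] {α : RealAction A} {φ : A →L[ℂ] ℂ}

/-- For an invariant functional the complexified action can be moved from one factor to the other:
`φ(b α_z(a)) = φ(α_{-z}(b) a)`, here for an eigenvector `b`. The right-hand side is continuous
in `a`, the left-hand side is not visibly so. -/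
theorem apply_mul_entireExtension (hinv : ∀ (t : ℝ) (a : A), φ (α.aut t a) = φ a)
    {a b : A} {c : ℝ} (hb : α.IsEigenvector b c) {f : ℂ → A} (hf : IsEntireExtension α a f)
    (z : ℂ) : φ (b * f z) = Complex.exp (-(Complex.I * z * c)) * φ (b * a) := by
  let ψ : A →L[ℂ] ℂ := φ.comp (ContinuousLinearMap.mul ℂ A b)
  have hF : Differentiable ℂ fun z => φ (b * f z) := ψ.differentiable.comp hf.1
  have hG : Differentiable ℂ fun z : ℂ => Complex.exp (-(Complex.I * z * c)) * φ (b * a) := by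
    fun_prop
  refine congrFun (eq_of_differentiable_of_eq_ofReal hF hG fun t => ?_) z
  rw [hf.2 t, ← hinv t (b * a), map_mul (α.aut t), hb t, smul_mul_assoc, map_smul, smul_eq_mul, ← mul_assoc,
    ← Complex.exp_add]
  simp

/-- The KMS condition can be checked on a total family of eigenvectors. -/
theorem isKMSState_of_eigenvectors (hφ : IsState φ) {β : ℝ} {ι : Type*} {e : ι → A} {ω : ι → ℝ}
    (he : ∀ i, α.IsEigenvector (e i) (ω i))
    (hdense : Dense (Submodule.span ℂ (Set.range e) : Set A))
    (h0 : ∀ i, ω i ≠ 0 → φ (e i) = 0)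
    (hβ : ∀ i j, φ (e i * e j) = Complex.exp (-(β * ω i)) * φ (e j * e i)) :
    IsKMSState α β φ := by
  have hinv := RealAction.invariant_of_eigenvectors he hdense h0
  let M := ContinuousLinearMap.mul ℂ A
  have hswap : ∀ j a, φ (a * e j) = Complex.exp (β * ω j) * φ (e j * a) := fun j a => by
    have : φ.comp (M.flip (e j)) = Complex.exp (β * ω j) • φ.comp (M (e j)) := by
      refine ContinuousLinearMap.ext_on hdense (Set.forall_mem_range.2 fun i => ?_)
      change φ (e i * e j) = Complex.exp (β * ω j) * φ (e j * e i)
      rw [hβ j i, ← mul_assoc, ← Complex.exp_add]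
      simp
    exact DFunLike.congr_fun this a
  refine ⟨hφ, fun _ a b f hf _ => ?_, fun h => ⟨fun a b => ?_, hinv⟩⟩
  · have : φ.comp (M a) = φ.comp (M.flip (f (Complex.I * β))) := by
      refine ContinuousLinearMap.ext_on hdense (Set.forall_mem_range.2 fun j => ?_)
      change φ (a * e j) = φ (e j * f (Complex.I * β))
      rw [apply_mul_entireExtension hinv (he j) hf, hswap, ← mul_assoc Complex.I, Complex.I_mul_I]
      simp
    exact DFunLike.congr_fun this b
  · have : φ.comp (M a) = φ.comp (M.flip a) := by
      refine ContinuousLinearMap.ext_on hdense (Set.forall_mem_range.2 fun j => ?_)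
      change φ (a * e j) = φ (e j * a)
      rw [hswap, h]
      simp
    exact DFunLike.congr_fun this b

/-- The ground state condition can be checked on a total family of eigenvectors. The bound it asks for
is obtained, for `a` in the span of the `e i`, from the Phragmen-Lindelöf principle with the constant
`‖φ‖ ‖a‖ ‖b‖`, which is what makes it pass to the closure. -/
theorem isGroundState_of_eigenvectors (hφ : IsState φ) {ι : Type*} {e : ι → A} {ω : ι → ℝ}
    (he : ∀ i, α.IsEigenvector (e i) (ω i))
    (hdense : Dense (Submodule.span ℂ (Set.range e) : Set A))
    (h0 : ∀ i, ω i ≠ 0 → φ (e i) = 0)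
    (hpos : ∀ i, 0 < ω i → ∀ j, φ (e i * e j) = 0) : IsGroundState α φ := by
  have hinv := RealAction.invariant_of_eigenvectors he hdense h0
  refine ⟨hφ, fun a b f _ hf => ⟨‖φ‖ * (‖a‖ * ‖b‖), fun z hz => ?_⟩⟩
  let M := ContinuousLinearMap.mul ℂ A
  have hpos' : ∀ i, 0 < ω i → ∀ b, φ (e i * b) = 0 := fun i hc b => by
    have : φ.comp (M (e i)) = 0 :=
      ContinuousLinearMap.ext_on hdense (Set.forall_mem_range.2 fun j => hpos i hc j)
    exact DFunLike.congr_fun this b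
  have hbdd : ∀ a ∈ Submodule.span ℂ (Set.range e), ∃ C : ℝ, ∀ z : ℂ, 0 < z.im → ‖φ (a * f z)‖ ≤ C := by
    intro a ha
    induction ha using Submodule.span_induction with
    | mem a ha =>
      obtain ⟨i, rfl⟩ := ha
      refine ⟨‖φ (e i * b)‖, fun z hz => ?_⟩
      rw [apply_mul_entireExtension hinv (he i) hf, norm_mul]
      rcases lt_or_ge 0 (ω i) with hc | hc
      · simp [hpos' i hc b]
      · refine mul_le_of_le_one_left (norm_nonneg _) ?_
        rw [Complex.norm_exp, Real.exp_le_one_iff]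
        simpa using mul_nonpos_of_nonneg_of_nonpos hz.le hc
    | zero => exact ⟨0, fun z _ => by simp⟩
    | add x y _ _ hx hy =>
      obtain ⟨C, hC⟩ := hx
      obtain ⟨C', hC'⟩ := hy
      refine ⟨C + C', fun z hz => ?_⟩
      rw [add_mul, map_add]
      exact (norm_add_le _ _).trans (add_le_add (hC z hz) (hC' z hz))
    | smul c x _ hx =>
      obtain ⟨C, hC⟩ := hx
      refine ⟨‖c‖ * C, fun z hz => ?_⟩
      rw [smul_mul_assoc, map_smul, norm_smul]
      exact mul_le_mul_of_nonneg_left (hC z hz) (norm_nonneg _)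
  refine hdense.induction (P := fun a => ‖φ (a * f z)‖ ≤ ‖φ‖ * (‖a‖ * ‖b‖)) (fun a ha => ?_)
    (isClosed_le (by fun_prop) (by fun_prop)) a
  obtain ⟨C, hC⟩ := hbdd a ha
  let ψ : A →L[ℂ] ℂ := φ.comp (M a)
  -- `w ↦ i w` carries the right half-plane to the upper half-plane
  have hF : Differentiable ℂ fun w : ℂ => φ (a * f (Complex.I * w)) :=
    ψ.differentiable.comp (hf.1.comp (by fun_prop))
  have key := PhragmenLindelof.right_half_plane_of_bounded_on_real (C := ‖φ‖ * (‖a‖ * ‖b‖))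
    (z := -Complex.I * z) hF.diffContOnCl ⟨1, by norm_num, 0, ?_⟩ ?_ (fun x => ?_)
    (by simpa using hz.le)
  · simpa [← mul_assoc] using key
  · refine Asymptotics.IsBigO.of_bound C ?_
    refine Filter.mem_inf_of_right fun w hw => ?_
    simpa using hC (Complex.I * w) (by simpa using hw)
  · refine Filter.isBoundedUnder_of_eventually_le (a := C) ?_
    filter_upwards [Filter.eventually_gt_atTop 0] with x hx
    exact hC _ (by simpa using hx)
  · have hx : Complex.I * (x * Complex.I) = ((-x : ℝ) : ℂ) := by
      rw [mul_left_comm, Complex.I_mul_I]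
      simp
    rw [hx, hf.2]
    calc ‖φ (a * α.aut (-x) b)‖ ≤ ‖φ‖ * ‖a * α.aut (-x) b‖ := φ.le_opNorm _
      _ ≤ ‖φ‖ * (‖a‖ * ‖b‖) := by
        gcongr
        exact (norm_mul_le _ _).trans_eq (by rw [StarAlgEquiv.norm_map])

/-- Positive functionals are hermitian (by polarisation). -/
theorem apply_star_mul_eq_conj (hφ : ∀ a : A, 0 ≤ φ (star a * a)) (a b : A) :
    φ (star a * b) = starRingEnd ℂ (φ (star b * a)) := by
  have him : ∀ x : A, (φ (star x * x)).im = 0 := fun x => ((Complex.le_def.1 (hφ x)).2).symm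
  have h1 := him (a + b)
  have h2 := him (a + Complex.I • b)
  simp only [star_add, star_smul, add_mul, mul_add, smul_mul_assoc, mul_smul_comm, map_add,
    map_smul, smul_eq_mul] at h1 h2
  simp [him] at h1 h2
  apply Complex.ext
  · simp; linarith
  · simp; linarith

end States

/-! ### Degrees and minimal common extensions -/

section Degree

variable {k : ℕ}

theorem rdot_add (r : Fin k → ℝ) (m n : Fin k → ℕ) : rdot r (m + n) = rdot r m + rdot r n := by
  simp [rdot, mul_add, Finset.sum_add_distrib]

theorem rdot_nonneg {r : Fin k → ℝ} (hr : ∀ i, 0 < r i) (n : Fin k → ℕ) : 0 ≤ rdot r n :=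
  Finset.sum_nonneg fun i _ => mul_nonneg (hr i).le (Nat.cast_nonneg _)

theorem eq_of_rdot_eq {r : Fin k → ℝ} (hr : LinearIndependent ℚ r) {m n : Fin k → ℕ}
    (h : rdot r m = rdot r n) : m = n := by
  have h0 : ∑ i, ((m i : ℚ) - n i) • r i = 0 := by
    rw [← sub_eq_zero, rdot, rdot, ← Finset.sum_sub_distrib] at h
    rw [← h]
    refine Finset.sum_congr rfl fun i _ => ?_
    rw [Rat.smul_def]
    push_cast
    ring
  funext i
  have := Fintype.linearIndependent_iff.1 hr _ h0 i
  exact_mod_cast sub_eq_zero.1 this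

end Degree

namespace FiniteKGraph

variable {k : ℕ} {V : Type u} [SmallCategory V] (Λ : FiniteKGraph k V)

theorem comp_vertex (μ : Λ.Path) : Λ.comp μ (Λ.vertex (Λ.s μ)) rfl = μ := by
  obtain ⟨a, b, f⟩ := μ
  refine (Λ.comp_mk f (𝟙 a) rfl).trans ?_
  simp

theorem vertex_comp (μ : Λ.Path) : Λ.comp (Λ.vertex (Λ.r μ)) μ rfl = μ := by
  obtain ⟨a, b, f⟩ := μ
  refine (Λ.comp_mk (𝟙 b) f rfl).trans ?_
  simp

theorem d_vertex (v : V) : Λ.d (Λ.vertex v) = 0 := Λ.deg_id v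

theorem s_eq_of_comp_eq {μ ν η ζ : Λ.Path} {h : Λ.s μ = Λ.r η} {h' : Λ.s ν = Λ.r ζ}
    (he : Λ.comp μ η h = Λ.comp ν ζ h') : Λ.s η = Λ.s ζ :=
  show Λ.s (Λ.comp μ η h) = Λ.s (Λ.comp ν ζ h') from congrArg Λ.s he

/-- If `ν η = σ ζ` and `μ η = τ ζ`, then `(η, ζ)` is a minimal extension of `(ν, σ)` if and only if
it is one of `(μ, τ)`: both say that `d(η) ∧ d(ζ) = 0`. -/
theorem degree_sup_iff {m n p q e f : Fin k → ℕ} (h : n + e = p + f) (h' : m + e = q + f) :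
    n + e = n ⊔ p ↔ q + f = q ⊔ m := by
  simp only [funext_iff, Pi.add_apply, Pi.sup_apply] at *
  refine forall_congr' fun i => ?_
  have := h i
  have := h' i
  omega

/-! ### The spanning elements of the Toeplitz algebra -/

theorem t_mul_q (μ : Λ.Path) : Λ.t μ * Λ.q (Λ.s μ) = Λ.t μ := by
  rw [q, Λ.isTCKFamily_t.t2 _ _ rfl, comp_vertex]

theorem q_mul_t (μ : Λ.Path) : Λ.q (Λ.r μ) * Λ.t μ = Λ.t μ := by
  rw [q, Λ.isTCKFamily_t.t2 _ _ rfl, vertex_comp]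

theorem star_q (v : V) : star (Λ.q v) = Λ.q v := (Λ.isTCKFamily_t.t1_proj v).isSelfAdjoint

theorem q_mul_q_of_ne {v w : V} (h : v ≠ w) : Λ.q v * Λ.q w = 0 := Λ.isTCKFamily_t.t1_orth v w h

theorem star_t_mul_q (μ : Λ.Path) : star (Λ.t μ) * Λ.q (Λ.r μ) = star (Λ.t μ) := by
  conv_rhs => rw [← Λ.q_mul_t μ, star_mul, star_q]

theorem t_mul_t_of_ne {μ ν : Λ.Path} (h : Λ.s μ ≠ Λ.r ν) : Λ.t μ * Λ.t ν = 0 := by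
  rw [← Λ.t_mul_q μ, ← Λ.q_mul_t ν, mul_assoc, ← mul_assoc (Λ.q _), Λ.q_mul_q_of_ne h]
  simp

theorem star_t_mul_t_of_d_eq [DecidableEq Λ.Path] {μ ν : Λ.Path} (h : Λ.d μ = Λ.d ν) :
    star (Λ.t ν) * Λ.t μ = if μ = ν then Λ.q (Λ.s μ) else 0 := by
  split_ifs with hμν
  · subst hμν
    exact Λ.isTCKFamily_t.t3 μ
  · rw [Λ.isTCKFamily_t.t5, Λ.minExt_eq_empty h.symm (Ne.symm hμν), Finset.sum_empty]

/-- The elements `t_μ t_ν⋆`, which span a dense ⋆-subalgebra. -/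
noncomputable def spanning (p : Λ.Path × Λ.Path) : Λ.ToeplitzAlgebra := Λ.t p.1 * star (Λ.t p.2)

theorem t_mul_star_t_mem (μ ν : Λ.Path) : Λ.t μ * star (Λ.t ν) ∈ Set.range Λ.spanning :=
  ⟨(μ, ν), rfl⟩

/-- The product of two spanning elements, before the paths are concatenated. -/
theorem spanning_mul (μ ν σ τ : Λ.Path) :
    Λ.t μ * star (Λ.t ν) * (Λ.t σ * star (Λ.t τ)) =
      ∑ p ∈ Λ.minExt ν σ, Λ.t μ * Λ.t p.1 * star (Λ.t τ * Λ.t p.2) := by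
  rw [mul_assoc, ← mul_assoc (star (Λ.t ν)), Λ.isTCKFamily_t.t5, Finset.sum_mul, Finset.mul_sum]
  refine Finset.sum_congr rfl fun p _ => ?_
  simp only [star_mul, mul_assoc]

theorem mul_mem_span {a b : Λ.ToeplitzAlgebra} (ha : a ∈ Submodule.span ℂ (Set.range Λ.spanning))
    (hb : b ∈ Submodule.span ℂ (Set.range Λ.spanning)) : a * b ∈ Submodule.span ℂ (Set.range Λ.spanning) := by
  induction ha, hb using Submodule.span_induction₂ with
  | mem_mem x y hx hy =>
    obtain ⟨⟨μ, ν⟩, rfl⟩ := hx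
    obtain ⟨⟨σ, τ⟩, rfl⟩ := hy
    rw [spanning, spanning, spanning_mul]
    refine Submodule.sum_mem _ fun p _ => ?_
    by_cases h : Λ.s μ = Λ.r p.1
    · by_cases h' : Λ.s τ = Λ.r p.2
      · rw [Λ.isTCKFamily_t.t2 _ _ h, Λ.isTCKFamily_t.t2 _ _ h']
        exact Submodule.subset_span (Λ.t_mul_star_t_mem _ _)
      · simp [Λ.t_mul_t_of_ne h']
    · simp [Λ.t_mul_t_of_ne h]
  | zero_left y hy => simp
  | zero_right x hx => simp
  | add_left x y z _ _ _ h h' => rw [add_mul]; exact add_mem h h'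
  | add_right x y z _ _ _ h h' => rw [mul_add]; exact add_mem h h'
  | smul_left c x y _ _ h => rw [smul_mul_assoc]; exact Submodule.smul_mem _ c h
  | smul_right c x y _ _ h => rw [mul_smul_comm]; exact Submodule.smul_mem _ c h

theorem star_mem_span {a : Λ.ToeplitzAlgebra} (ha : a ∈ Submodule.span ℂ (Set.range Λ.spanning)) :
    star a ∈ Submodule.span ℂ (Set.range Λ.spanning) := by
  induction ha using Submodule.span_induction with
  | mem x hx =>
    obtain ⟨⟨μ, ν⟩, rfl⟩ := hx
    simpa [spanning] using Submodule.subset_span (R := ℂ) (Λ.t_mul_star_t_mem ν μ)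
  | zero => simp
  | add x y _ _ h h' => rw [star_add]; exact add_mem h h'
  | smul c x _ h => rw [star_smul]; exact Submodule.smul_mem _ _ h

theorem dense_span : Dense (Submodule.span ℂ (Set.range Λ.spanning) : Set Λ.ToeplitzAlgebra) := by
  have hle : ∀ a ∈ NonUnitalStarAlgebra.adjoin ℂ (Set.range Λ.t),
      a ∈ Submodule.span ℂ (Set.range Λ.spanning) := fun a ha => by
    induction ha using NonUnitalStarAlgebra.adjoin_induction with
    | mem x hx =>
      obtain ⟨μ, rfl⟩ := hx
      have := Submodule.subset_span (R := ℂ) (Λ.t_mul_star_t_mem μ (Λ.vertex (Λ.s μ)))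
      rwa [← q, star_q, t_mul_q] at this
    | add x y _ _ hx hy => exact add_mem hx hy
    | zero => exact zero_mem _
    | mul x y _ _ hx hy => exact Λ.mul_mem_span hx hy
    | smul c x _ hx => exact Submodule.smul_mem _ c hx
    | star x _ hx => exact Λ.star_mem_span hx
  intro a
  refine closure_mono (show (NonUnitalStarAlgebra.adjoin ℂ (Set.range Λ.t) : Set Λ.ToeplitzAlgebra) ⊆
    Submodule.span ℂ (Set.range Λ.spanning) from hle) ?_
  have ha : a ∈ (NonUnitalStarAlgebra.adjoin ℂ (Set.range Λ.t)).topologicalClosure := by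
    rw [closure_adjoin_t]
    trivial
  exact ha

/-! ### The dynamics on the spanning elements -/

theorem isEigenvector_t (r : Fin k → ℝ) (μ : Λ.Path) :
    (Λ.dynamics r).IsEigenvector (Λ.t μ) (rdot r (Λ.d μ)) := fun t => by
  change Λ.gaugeAction _ (Λ.t μ) = _
  rw [gaugeAction_t]
  congr 1
  have hprod : ∀ F : Fin k → Circle, ((∏ i, F i : Circle) : ℂ) = ∏ i, (F i : ℂ) :=
    fun F => map_prod Circle.coeHom F _
  rw [hprod]
  simp only [Circle.coe_pow, Circle.coe_exp, ← Complex.exp_nat_mul, ← Complex.exp_sum]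
  congr 1
  simp only [rdot]
  push_cast
  rw [Finset.mul_sum]
  exact Finset.sum_congr rfl fun i _ => by ring

theorem isEigenvector_star_t (r : Fin k → ℝ) (μ : Λ.Path) :
    (Λ.dynamics r).IsEigenvector (star (Λ.t μ)) (-rdot r (Λ.d μ)) :=
  (Λ.isEigenvector_t r μ).star

theorem isEigenvector_q (r : Fin k → ℝ) (v : V) : (Λ.dynamics r).IsEigenvector (Λ.q v) 0 := by
  have h := Λ.isEigenvector_t r (Λ.vertex v)
  rwa [d_vertex, show rdot r 0 = 0 by simp [rdot]] at h

theorem isEigenvector_t_mul_star_t (r : Fin k → ℝ) (μ ν : Λ.Path) :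
    (Λ.dynamics r).IsEigenvector (Λ.t μ * star (Λ.t ν)) (rdot r (Λ.d μ) - rdot r (Λ.d ν)) :=
  (Λ.isEigenvector_t r μ).mul (Λ.isEigenvector_star_t r ν)

end FiniteKGraph

/-! ### Functionals given on the spanning elements -/

namespace FiniteKGraph

variable {k : ℕ} {V : Type u} [SmallCategory V] (Λ : FiniteKGraph k V)
variable {φ : Λ.ToeplitzAlgebra →L[ℂ] ℂ} {r : Fin k → ℝ} {β : ℝ}

/-- The terms of the two expansions of `t_μ t_ν⋆ t_σ t_τ⋆` and `t_σ t_τ⋆ t_μ t_ν⋆` that a functional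
supported on the diagonal does not kill correspond under `(η, ζ) ↦ (ζ, η)`. -/
theorem mem_minExt_swap {μ ν σ τ : Λ.Path}
    {p : Λ.Path × Λ.Path} (hp : p ∈ Λ.minExt ν σ) {h : Λ.s μ = Λ.r p.1} {h' : Λ.s τ = Λ.r p.2}
    (he : Λ.comp μ p.1 h = Λ.comp τ p.2 h') :
    p.swap ∈ Λ.minExt τ μ ∧ ∃ (g : Λ.s σ = Λ.r p.2) (g' : Λ.s ν = Λ.r p.1),
      Λ.comp σ p.2 g = Λ.comp ν p.1 g' := by
  obtain ⟨g', g, he', hd⟩ := Λ.mem_minExt.1 hp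
  refine ⟨Λ.mem_minExt.2 ⟨h', h, he.symm, ?_⟩, g, g', he'.symm⟩
  have e1 := congrArg Λ.d he
  have e2 := congrArg Λ.d he'
  rw [d_comp, d_comp] at e1 e2
  rw [d_comp] at hd
  refine (Λ.d_comp _ _ _).trans ((degree_sup_iff e2 e1).1 hd)

/-- The KMS condition on products of spanning elements. By (T5) the two sides are sums over
`Λ^min(ν, σ)` and `Λ^min(τ, μ)`; `mem_minExt_swap` matches the terms that do not vanish. -/
theorem apply_mul_of_diagonal [DecidableEq Λ.Path]
    (h : ∀ μ ν : Λ.Path, φ (Λ.t μ * star (Λ.t ν)) =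
      if μ = ν then (Real.exp (-β * rdot r (Λ.d μ)) : ℂ) * φ (Λ.q (Λ.s μ)) else 0)
    (μ ν σ τ : Λ.Path) :
    φ (Λ.t μ * star (Λ.t ν) * (Λ.t σ * star (Λ.t τ))) =
      Complex.exp (-(β * (rdot r (Λ.d μ) - rdot r (Λ.d ν) : ℝ))) *
        φ (Λ.t σ * star (Λ.t τ) * (Λ.t μ * star (Λ.t ν))) := by
  classical
  -- `μ η = τ ζ` for `p = (η, ζ)`
  let C : Λ.Path → Λ.Path → Λ.Path × Λ.Path → Prop := fun μ τ p =>
    ∃ (g : Λ.s μ = Λ.r p.1) (g' : Λ.s τ = Λ.r p.2), Λ.comp μ p.1 g = Λ.comp τ p.2 g'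
  -- the value of `φ` on a single term of the expansion
  have hterm : ∀ (μ τ : Λ.Path) (p : Λ.Path × Λ.Path),
      φ (Λ.t μ * Λ.t p.1 * star (Λ.t τ * Λ.t p.2)) = if C μ τ p then
        (Real.exp (-β * (rdot r (Λ.d μ) + rdot r (Λ.d p.1))) : ℂ) * φ (Λ.q (Λ.s p.1)) else 0 := by
    intro μ τ p
    by_cases g : Λ.s μ = Λ.r p.1
    swap
    · rw [if_neg (fun hC => g hC.1), Λ.t_mul_t_of_ne g, zero_mul, map_zero]
    by_cases g' : Λ.s τ = Λ.r p.2
    swap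
    · rw [if_neg (fun hC => g' hC.2.1), Λ.t_mul_t_of_ne g', star_zero, mul_zero, map_zero]
    rw [Λ.isTCKFamily_t.t2 _ _ g, Λ.isTCKFamily_t.t2 _ _ g', h]
    refine if_congr ⟨fun hC => ⟨g, g', hC⟩, fun hC => hC.2.2⟩ ?_ rfl
    rw [d_comp, rdot_add]
    rfl
  rw [spanning_mul, spanning_mul, map_sum, map_sum]
  simp only [hterm]
  rw [← Finset.sum_filter, ← Finset.sum_filter, Finset.mul_sum]
  refine Finset.sum_nbij' Prod.swap Prod.swap ?_ ?_ (fun _ _ => rfl) (fun _ _ => rfl) ?_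
  · intro p hp
    obtain ⟨hp, g, g', he⟩ := Finset.mem_filter.1 hp
    exact Finset.mem_filter.2 (Λ.mem_minExt_swap hp he)
  · intro p hp
    obtain ⟨hp, g, g', he⟩ := Finset.mem_filter.1 hp
    exact Finset.mem_filter.2 (Λ.mem_minExt_swap hp he)
  · intro p hp
    obtain ⟨hp, g, g', he⟩ := Finset.mem_filter.1 hp
    obtain ⟨f, f', he', -⟩ := Λ.mem_minExt.1 hp
    -- `d(ν) + d(η) = d(σ) + d(ζ)` accounts for the exponential factor
    have hd := congrArg (fun μ => rdot r (Λ.d μ)) he'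
    simp only [d_comp, rdot_add] at hd
    have hs : Λ.s p.1 = Λ.s p.2 := Λ.s_eq_of_comp_eq he
    change _ = _ * (_ * φ (Λ.q (Λ.s p.2)))
    rw [← hs, ← mul_assoc]
    congr 1
    simp only [Prod.fst_swap]
    rw [← Complex.ofReal_mul, ← Complex.ofReal_neg, ← Complex.ofReal_exp, ← Complex.ofReal_mul,
      ← Real.exp_add, ← hd]
    congr 2
    ring

theorem isKMSState_of_diagonal [DecidableEq Λ.Path] (hφ : IsState φ)
    (h : ∀ μ ν : Λ.Path, φ (Λ.t μ * star (Λ.t ν)) =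
      if μ = ν then (Real.exp (-β * rdot r (Λ.d μ)) : ℂ) * φ (Λ.q (Λ.s μ)) else 0) :
    IsKMSState (Λ.dynamics r) β φ := by
  refine isKMSState_of_eigenvectors hφ (e := Λ.spanning)
    (fun p => Λ.isEigenvector_t_mul_star_t r p.1 p.2) Λ.dense_span (fun p hp => ?_)
    fun p p' => Λ.apply_mul_of_diagonal h _ _ _ _
  rw [spanning, h, if_neg]
  intro he
  exact hp (by rw [he, sub_self])

/-- If `d(μ) ≠ 0`, every term of the expansion of `t_μ t_ν⋆ t_σ t_τ⋆` has a left factor `t_{μη}` with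
`d(μη) ≠ 0`, so `φ` vanishes on the product; the frequency of `t_μ t_ν⋆` can only be positive in that
case. -/
theorem isGroundState_of_apply_eq_zero (hr : ∀ i, 0 < r i) (hφ : IsState φ)
    (h : ∀ μ ν : Λ.Path, 0 < rdot r (Λ.d μ) ∨ 0 < rdot r (Λ.d ν) →
      φ (Λ.t μ * star (Λ.t ν)) = 0) : IsGroundState (Λ.dynamics r) φ := by
  refine isGroundState_of_eigenvectors hφ (e := Λ.spanning)
    (fun p => Λ.isEigenvector_t_mul_star_t r p.1 p.2) Λ.dense_span (fun p hp => h _ _ ?_) ?_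
  · have h1 := rdot_nonneg hr (Λ.d p.1)
    have h2 := rdot_nonneg hr (Λ.d p.2)
    by_contra! hc
    exact hp (by linarith)
  · rintro ⟨μ, ν⟩ hpos ⟨σ, τ⟩
    have h2 := rdot_nonneg hr (Λ.d ν)
    rw [spanning, spanning, spanning_mul, map_sum]
    refine Finset.sum_eq_zero fun p _ => ?_
    by_cases g : Λ.s μ = Λ.r p.1
    swap
    · rw [Λ.t_mul_t_of_ne g, zero_mul, map_zero]
    by_cases g' : Λ.s τ = Λ.r p.2
    swap
    · rw [Λ.t_mul_t_of_ne g', star_zero, mul_zero, map_zero]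
    rw [Λ.isTCKFamily_t.t2 _ _ g, Λ.isTCKFamily_t.t2 _ _ g']
    refine h _ _ (Or.inl ?_)
    rw [d_comp, rdot_add]
    have h3 := rdot_nonneg hr (Λ.d p.1)
    dsimp only at hpos
    linarith

end FiniteKGraph

/-! ### Consequences of the KMS and ground state conditions -/

section

variable {A : Type w} [NonUnitalCStarAlgebra A] {α : RealAction A} {φ : A →L[ℂ] ℂ} {β : ℝ}

/-- The KMS condition for eigenvectors, uniformly in `β ≥ 0`. -/
theorem IsKMSState.apply_mul (h : IsKMSState α β φ) (hβ : 0 ≤ β) {a b : A} {c c' : ℝ}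
    (ha : α.IsEigenvector a c) (hb : α.IsEigenvector b c') :
    φ (a * b) = (Real.exp (-β * c) : ℂ) * φ (b * a) := by
  rcases hβ.eq_or_lt with rfl | hβ
  · simpa using (h.2.2 rfl).1 a b
  · rw [h.2.1 hβ a b _ ha.isEntireExtension hb.isAnalyticElement, ← mul_assoc Complex.I,
      Complex.I_mul_I, mul_smul_comm, map_smul, smul_eq_mul]
    simp

/-- A ground state vanishes on `a b` when `b` has negative frequency, since
`φ(a α_z(b)) = e^{izc} φ(ab)` is then unbounded on the positive imaginary axis. -/
theorem IsGroundState.apply_mul_eq_zero (h : IsGroundState α φ) {a b : A} {c c' : ℝ}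
    (ha : α.IsEigenvector a c') (hb : α.IsEigenvector b c) (hc : c < 0) : φ (a * b) = 0 := by
  obtain ⟨C, hC⟩ := h.2 a b _ ha.isAnalyticElement hb.isEntireExtension
  by_contra hne
  have hlim : Filter.Tendsto (fun y : ℝ => Real.exp (-c * y) * ‖φ (a * b)‖) Filter.atTop
      Filter.atTop :=
    (Real.tendsto_exp_atTop.comp (Filter.tendsto_id.const_mul_atTop (neg_pos.2 hc))).atTop_mul_const
      (norm_pos_iff.2 hne)
  obtain ⟨y, hy, hy0⟩ := ((hlim.eventually_gt_atTop C).and (Filter.eventually_gt_atTop 0)).exists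
  have hle := hC (Complex.I * y) (by simpa using hy0)
  rw [mul_smul_comm, map_smul, norm_smul, Complex.norm_exp, ← mul_assoc Complex.I,
    Complex.I_mul_I] at hle
  have : (-1 * (y : ℂ) * c).re = -c * y := by simp [mul_comm]
  rw [this] at hle
  exact absurd hy (not_lt.2 hle)

end

namespace FiniteKGraph

variable {k : ℕ} {V : Type u} [SmallCategory V] (Λ : FiniteKGraph k V)
variable {φ : Λ.ToeplitzAlgebra →L[ℂ] ℂ} {r : Fin k → ℝ} {β : ℝ}

theorem apply_t_mul_star_t_of_d_eq [DecidableEq Λ.Path] (h : IsKMSState (Λ.dynamics r) β φ)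
    (hβ : 0 ≤ β) {μ ν : Λ.Path} (hd : Λ.d μ = Λ.d ν) :
    φ (Λ.t μ * star (Λ.t ν)) =
      if μ = ν then (Real.exp (-β * rdot r (Λ.d μ)) : ℂ) * φ (Λ.q (Λ.s μ)) else 0 := by
  rw [h.apply_mul hβ (Λ.isEigenvector_t r μ) (Λ.isEigenvector_star_t r ν),
    Λ.star_t_mul_t_of_d_eq hd]
  split_ifs <;> simp

/-- A KMS state vanishes on the `t_μ t_ν⋆` of nonzero frequency: for `β > 0` this is the KMS
condition for `t_μ t_ν⋆` and the vertex projection `q_{r(ν)}`, for `β = 0` it is invariance. -/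
theorem apply_t_mul_star_t_of_rdot_ne (h : IsKMSState (Λ.dynamics r) β φ) (hβ : 0 ≤ β)
    {μ ν : Λ.Path} (hd : rdot r (Λ.d μ) ≠ rdot r (Λ.d ν)) :
    φ (Λ.t μ * star (Λ.t ν)) = 0 := by
  set a := Λ.t μ * star (Λ.t ν) with ha
  set c := rdot r (Λ.d μ) - rdot r (Λ.d ν) with hc
  have hc0 : c ≠ 0 := sub_ne_zero.2 hd
  have hea : (Λ.dynamics r).IsEigenvector a c := Λ.isEigenvector_t_mul_star_t r μ ν
  rcases hβ.eq_or_lt with rfl | hβ0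
  · -- a time at which the phase is `-1`
    have hinv := (h.2.2 rfl).2 (Real.pi / c) a
    have hphase : Complex.I * ((Real.pi / c : ℝ) : ℂ) * c = Real.pi * Complex.I := by
      push_cast
      field_simp
    rw [hea, hphase, Complex.exp_pi_mul_I, map_smul, smul_eq_mul, neg_one_mul] at hinv
    exact CharZero.neg_eq_self_iff.1 hinv
  · have haq : a * Λ.q (Λ.r ν) = a := by rw [ha, mul_assoc, star_t_mul_q]
    have hkms := h.apply_mul hβ hea (Λ.isEigenvector_q r (Λ.r ν))
    rw [haq] at hkms
    by_cases hrr : Λ.r ν = Λ.r μ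
    · have hqa : Λ.q (Λ.r ν) * a = a := by rw [ha, hrr, ← mul_assoc, q_mul_t]
      rw [hqa] at hkms
      have h1 : (Real.exp (-β * c) : ℂ) ≠ 1 := by
        rw [Complex.ofReal_ne_one, Ne, Real.exp_eq_one_iff]
        exact mul_ne_zero (neg_ne_zero.2 hβ0.ne') hc0
      by_contra hne
      exact h1 (mul_right_cancel₀ hne (by rw [one_mul]; exact hkms.symm))
    · have hqa : Λ.q (Λ.r ν) * a = 0 := by
        rw [ha, ← Λ.q_mul_t μ, ← mul_assoc, ← mul_assoc, Λ.q_mul_q_of_ne hrr]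
        simp
      rw [hkms, hqa, map_zero, mul_zero]

theorem apply_t_mul_star_t_of_isGroundState (h : IsGroundState (Λ.dynamics r) φ) {μ ν : Λ.Path}
    (hpos : 0 < rdot r (Λ.d μ) ∨ 0 < rdot r (Λ.d ν)) : φ (Λ.t μ * star (Λ.t ν)) = 0 := by
  have key : ∀ μ ν : Λ.Path, 0 < rdot r (Λ.d ν) → φ (Λ.t μ * star (Λ.t ν)) = 0 := fun μ ν hν =>
    h.apply_mul_eq_zero (Λ.isEigenvector_t r μ) (Λ.isEigenvector_star_t r ν) (neg_lt_zero.2 hν)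
  rcases hpos with hμ | hν
  · have := apply_star_mul_eq_conj h.1.1 (star (Λ.t μ)) (star (Λ.t ν))
    simpa [key ν μ hμ] using this
  · exact key μ ν hν

end FiniteKGraph

theorem proposition3p1 {k : ℕ} {V : Type u} [SmallCategory V] (Λ : FiniteKGraph k V)
    (hΛ : Λ.NoSources) [DecidableEq Λ.Path] (r : Fin k → ℝ) (hr : ∀ i, 0 < r i)
    (β : ℝ) (hβ : 0 ≤ β) (φ : Λ.ToeplitzAlgebra →L[ℂ] ℂ) (hφ : IsState φ) :
    (IsKMSState (Λ.dynamics r) β φ →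
      ∀ μ ν : Λ.Path, Λ.d μ = Λ.d ν →
        φ (Λ.t μ * star (Λ.t ν)) =
          if μ = ν then (Real.exp (-β * rdot r (Λ.d μ)) : ℂ) * φ (Λ.q (Λ.s μ)) else 0) ∧
    ((∀ μ ν : Λ.Path, φ (Λ.t μ * star (Λ.t ν)) =
          if μ = ν then (Real.exp (-β * rdot r (Λ.d μ)) : ℂ) * φ (Λ.q (Λ.s μ)) else 0) →
      IsKMSState (Λ.dynamics r) β φ) ∧
    (LinearIndependent ℚ r →
      (IsKMSState (Λ.dynamics r) β φ ↔
        ∀ μ ν : Λ.Path, φ (Λ.t μ * star (Λ.t ν)) =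
          if μ = ν then (Real.exp (-β * rdot r (Λ.d μ)) : ℂ) * φ (Λ.q (Λ.s μ)) else 0)) ∧
    (IsGroundState (Λ.dynamics r) φ ↔
      ∀ μ ν : Λ.Path, 0 < rdot r (Λ.d μ) ∨ 0 < rdot r (Λ.d ν) →
        φ (Λ.t μ * star (Λ.t ν)) = 0) := by
  have hiff : LinearIndependent ℚ r → IsKMSState (Λ.dynamics r) β φ →
      ∀ μ ν : Λ.Path, φ (Λ.t μ * star (Λ.t ν)) =
        if μ = ν then (Real.exp (-β * rdot r (Λ.d μ)) : ℂ) * φ (Λ.q (Λ.s μ)) else 0 := by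
    intro hli h μ ν
    by_cases hd : Λ.d μ = Λ.d ν
    · exact Λ.apply_t_mul_star_t_of_d_eq h hβ hd
    · rw [if_neg fun he => hd (congrArg Λ.d he)]
      exact Λ.apply_t_mul_star_t_of_rdot_ne h hβ fun he => hd (eq_of_rdot_eq hli he)
  exact ⟨fun h _ _ hd => Λ.apply_t_mul_star_t_of_d_eq h hβ hd, Λ.isKMSState_of_diagonal hφ,
    fun hli => ⟨hiff hli, Λ.isKMSState_of_diagonal hφ⟩,
    fun h _ _ hpos => Λ.apply_t_mul_star_t_of_isGroundState h hpos,
    Λ.isGroundState_of_apply_eq_zero hr hφ⟩
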